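/- For a closed set $A\subset\mathbb{R}^D$ let $Med(A)$ be its medial axis, i.e. the set of points $z\in\mathbb{R}^D$ for which there are $p\neq q$ in $A$ with $\|p-z\|=\|q-z\|=d(z,A)$, and let $\tau_A=\inf_{z\in Med(A)}d(z,A)\in[0,\infty]$ be its reach. Let $M\subset\mathbb{R}^D$ be a compact (embedded, boundaryless, at least $C^1$) submanifold with reach $0<\tau_M<\infty$. Let $q_1\neq q_2$ be a reach attaining pair of $M$ with axis point $z_0$, that is, $q_1,q_2\in M$, $z_0\in Med(M)$, and $q_1,q_2$ belong to the closed ball of centre $z_0$ and radius $\tau_M$; suppose that $\|q_1-q_2\|<2\tau_M$. Then $\|q_1-z_0\|=\|q_2-z_0\|=\tau_M$, and the shorter arc $c_{z_0}(q_1,q_2)$, with endpoints $q_1$ and $q_2$, of the circle of centre $z_0$ and radius $\tau_M$ through $q_1$ and $q_2$ is contained in $M$. Moreover this arc, which has constant curvature $1/\tau_M$ and length $\tau_M\cdot\angle(q_1-z_0,q_2-z_0)$, is the geodesic of $M$ joining $q_1$ and $q_2$: its smooth arc-length parametrization from $q_1$ to $q_2$ has minimal length $\int\|c'(t)\|\,dt$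 among all $C^1$ paths $c$ in $M$ from $q_1$ to $q_2$; it is the only arc-length parametrized $C^1$ path from $q_1$ to $q_2$ in $M$ of minimal length; and every $C^1$ path from $q_1$ to $q_2$ in $M$ of minimal length has image $c_{z_0}(q_1,q_2)$. -/

import Mathlib

open scoped ContDiff

/-- The medial axis of `A`: the points having at least two nearest neighbours on `A`. -/
def medialAxis {D : ℕ} (A : Set (EuclideanSpace ℝ (Fin D))) : Set (EuclideanSpace ℝ (Fin D)) :=
  {z | ∃ p ∈ A, ∃ q ∈ A, p ≠ q ∧ dist p z = Metric.infDist z A ∧ dist q z = Metric.infDist z A}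

/-- The reach of `A`: the infimum over the medial axis of the distance to `A`.
It takes values in `[0, ∞]`, and is `∞` when the medial axis is empty. -/
noncomputable def reach {D : ℕ} (A : Set (EuclideanSpace ℝ (Fin D))) : ENNReal :=
  ⨅ z ∈ medialAxis A, Metric.infEDist z A

/-- `M` is an embedded `d`-dimensional submanifold of `ℝ^D` without boundary, of class `C^k`:
around each of its points there is a `C^k` diffeomorphism between open sets of `ℝ^D`
that straightens `M` to a `d`-dimensional linear subspace. -/
def IsSubmanifold {D : ℕ} (k : ℕ∞) (d : ℕ) (M : Set (EuclideanSpace ℝ (Fin D))) : Prop :=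
  ∀ p ∈ M, ∃ Φ : OpenPartialHomeomorph (EuclideanSpace ℝ (Fin D)) (EuclideanSpace ℝ (Fin D)),
    p ∈ Φ.source ∧ ContDiffOn ℝ k Φ Φ.source ∧ ContDiffOn ℝ k Φ.symm Φ.target ∧
      ∃ V : Submodule ℝ (EuclideanSpace ℝ (Fin D)), Module.finrank ℝ V = d ∧
        ∀ x ∈ Φ.source, (x ∈ M ↔ Φ x ∈ V)

/-- `(q₁, q₂)` is a reach attaining pair of `M` with axis point `z`: two distinct points of `M`
in the closed ball centred at the medial axis point `z`, of radius the reach of `M`. -/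
structure IsReachAttainingPair {D : ℕ} (M : Set (EuclideanSpace ℝ (Fin D)))
    (q₁ q₂ z : EuclideanSpace ℝ (Fin D)) : Prop where
  left_mem : q₁ ∈ M
  right_mem : q₂ ∈ M
  ne : q₁ ≠ q₂
  axis_mem : z ∈ medialAxis M
  left_le : edist q₁ z ≤ reach M
  right_le : edist q₂ z ≤ reach M

/-- For `q₁, q₂` on a common sphere with centre `z` and not antipodal on it, the shorter arc with
endpoints `q₁` and `q₂` of the circle with centre `z` through them, i.e. the part of that circle
inside the convex angular sector with apex `z` spanned by `q₁` and `q₂`. -/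
def shorterArc {D : ℕ} (z q₁ q₂ : EuclideanSpace ℝ (Fin D)) : Set (EuclideanSpace ℝ (Fin D)) :=
  {x | dist x z = dist q₁ z ∧
    ∃ a b : ℝ, 0 ≤ a ∧ 0 ≤ b ∧ x - z = a • (q₁ - z) + b • (q₂ - z)}

/-- `c : [a, b] → M` is a continuously differentiable path from `p` to `q` in `M`. -/
structure IsPathIn {D : ℕ} (M : Set (EuclideanSpace ℝ (Fin D)))
    (p q : EuclideanSpace ℝ (Fin D)) (a b : ℝ) (c : ℝ → EuclideanSpace ℝ (Fin D)) : Prop where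
  le : a ≤ b
  contDiffOn : ContDiffOn ℝ 1 c (Set.Icc a b)
  mapsTo : Set.MapsTo c (Set.Icc a b) M
  source : c a = p
  target : c b = q

/-- The length of the path `c : [a, b] → ℝ^D`. -/
noncomputable def pathLength {D : ℕ} (a b : ℝ) (c : ℝ → EuclideanSpace ℝ (Fin D)) : ℝ :=
  ∫ t in a..b, ‖derivWithin c (Set.Icc a b) t‖

/-- `c : [a, b] → M` is a geodesic from `p` to `q`, that is, a path in `M` from `p` to `q` whose
length is minimal among all the paths in `M` from `p` to `q`. -/
def IsGeodesic {D : ℕ} (M : Set (EuclideanSpace ℝ (Fin D)))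
    (p q : EuclideanSpace ℝ (Fin D)) (a b : ℝ) (c : ℝ → EuclideanSpace ℝ (Fin D)) : Prop :=
  IsPathIn M p q a b c ∧
    ∀ (a' b' : ℝ) (c' : ℝ → EuclideanSpace ℝ (Fin D)),
      IsPathIn M p q a' b' c' → pathLength a b c ≤ pathLength a' b' c'

/-! Write `R` for the reach. Points at distance less than `R` from `M` have a unique nearest point,
and the open ball of radius `R` about the axis point misses `M`, so both points of the pair lie on
its boundary sphere.

The arc lies in `M` by a midpoint argument (`arc_midpoint_mem`). Let `c` be the midpoint of a chord
with ends in `M` on that sphere, and let `p` be its nearest point on `M`. If `c ≠ p`, the open ball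
of radius `R` touching `M` at `p`, with centre `y` on the ray from `p` through `c`, misses `M`
(`le_infDist_normal_ray`). The chord ends are outside this ball, so by the parallelogram law `c` is
at least as far from `y` as from the axis point `z`. Hence `‖c - p‖ ≤ R - ‖c - z‖`; the reverse
inequality holds because `p` is outside the ball about `z`. Equality puts `p` at the midpoint of the
arc. As `M` is closed, the whole arc follows (`circleArc_mem`).

Minimality uses only that `M` avoids the ball. Radial projection to the sphere does not increase
length there, and a path on the unit sphere is at least as long as the angle between its ends. In
the equality case the path stays on the sphere, its angles to the two ends add up to the full angle,
and these angles determine each of its points (`eq_cos_smul_add_sin_smul`). -/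

/-- If `p` is the only nearest point of `x` on the compact set `M`, then the nearest points of the
points close to `x` are close to `p`. -/
theorem exists_radius_nearest_close {X : Type*} [MetricSpace X] {M : Set X} (hM : IsCompact M)
    {x p : X} (huniq : ∀ q ∈ M, dist x q = Metric.infDist x M → q = p) {δ : ℝ} (hδ : 0 < δ) :
    ∃ r > 0, ∀ y, dist y x < r → ∀ q ∈ M, dist y q = Metric.infDist y M → dist p q < δ := by
  have hK : IsCompact (M \ Metric.ball p δ) := hM.diff Metric.isOpen_ball
  rcases (M \ Metric.ball p δ).eq_empty_or_nonempty with he | hne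
  · refine ⟨1, one_pos, fun y _ q hq _ => ?_⟩
    by_contra hlt
    have : q ∈ M \ Metric.ball p δ := ⟨hq, by simpa [dist_comm] using hlt⟩
    simp [he] at this
  · obtain ⟨m, hm, hmin⟩ := hK.exists_isMinOn hne (f := fun q => dist x q) (by fun_prop)
    have hgap : Metric.infDist x M < dist x m := by
      refine lt_of_le_of_ne (Metric.infDist_le_dist_of_mem hm.1) fun h => hm.2 ?_
      rw [huniq m hm.1 h.symm]
      exact Metric.mem_ball_self hδ
    -- Half the gap: moving `x` changes the distance to a far point and the distance to `M` by less
    -- than half the gap each.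
    refine ⟨(dist x m - Metric.infDist x M) / 2, by linarith, fun y hy q hq hyq => ?_⟩
    by_contra hlt
    have hq' : q ∈ M \ Metric.ball p δ := ⟨hq, by simpa [dist_comm] using hlt⟩
    have h1 : dist x m ≤ dist x q := hmin hq'
    have h2 : dist x q ≤ dist x y + dist y q := dist_triangle _ _ _
    have h3 : Metric.infDist y M ≤ Metric.infDist x M + dist y x := Metric.infDist_le_infDist_add_dist
    rw [dist_comm x y] at h2
    linarith

/-! ### Nearest points, tangent balls and midpoints of arcs -/

section Projection

variable {E : Type*} [NormedAddCommGroup E] [InnerProductSpace ℝ E]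

/-- Moving away from the unique nearest point increases the distance at a rate arbitrarily close
to one. -/
theorem eventually_infDist_growth {M : Set E} (hM : IsCompact M) {x p : E} (hp : p ∈ M)
    (hxp : dist x p = Metric.infDist x M)
    (huniq : ∀ q ∈ M, dist x q = Metric.infDist x M → q = p) (hpos : 0 < Metric.infDist x M)
    {η : ℝ} (hη : 0 < η) (hη1 : η ≤ 1) :
    ∃ r > 0, ∀ ε, 0 < ε → ε < r → Metric.infDist x M + (1 - η) * ε <
      Metric.infDist (x + ε • ((Metric.infDist x M)⁻¹ • (x - p))) M := by
  set d := Metric.infDist x M with hd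
  -- With `‖p - q‖ < η * d`, the component of `x - q` along `u` exceeds `(1 - η) * d`, and the
  -- growth follows by expanding the square.
  obtain ⟨r, hr, hclose⟩ := exists_radius_nearest_close hM huniq (mul_pos hη hpos)
  refine ⟨r, hr, fun ε hε hεr => ?_⟩
  set u := d⁻¹ • (x - p) with hu
  have hnxp : ‖x - p‖ = d := by rw [← dist_eq_norm, hxp]
  have hnu : ‖u‖ = 1 := by
    rw [hu, norm_smul, hnxp, norm_inv, Real.norm_of_nonneg hpos.le, inv_mul_cancel₀ hpos.ne']
  set y := x + ε • u with hy
  obtain ⟨q, hq, hyq⟩ := hM.exists_infDist_eq_dist ⟨p, hp⟩ y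
  have hyx : dist y x < r := by
    rw [hy, dist_eq_norm, add_sub_cancel_left, norm_smul, hnu, Real.norm_of_nonneg hε.le]
    linarith
  have hpq := hclose y hyx q hq hyq.symm
  have hxq : d ≤ ‖x - q‖ := by
    rw [← dist_eq_norm]; exact Metric.infDist_le_dist_of_mem hq
  have hinner : d - ‖p - q‖ ≤ inner ℝ (x - q) u := by
    have h1 : inner ℝ (x - q) u = inner ℝ (x - p) u + inner ℝ (p - q) u := by
      rw [← inner_add_left, sub_add_sub_cancel]
    have h2 : inner ℝ (x - p) u = d := by
      rw [hu, inner_smul_right, real_inner_self_eq_norm_sq, hnxp]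
      field_simp
    have h3 : |inner ℝ (p - q) u| ≤ ‖p - q‖ := by
      simpa [hnu] using abs_real_inner_le_norm (p - q) u
    have := neg_abs_le (inner ℝ (p - q) u)
    linarith
  have hsq : ‖y - q‖ ^ 2 = ‖x - q‖ ^ 2 + 2 * ε * inner ℝ (x - q) u + ε ^ 2 := by
    have : y - q = (x - q) + ε • u := by rw [hy]; abel
    rw [this, norm_add_sq_real, inner_smul_right, norm_smul, hnu, Real.norm_of_nonneg hε.le]
    ring
  rw [hyq, dist_eq_norm]
  rw [dist_eq_norm] at hpq
  refine lt_of_pow_lt_pow_left₀ 2 (norm_nonneg _) ?_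
  rw [hsq]
  have h1 : ε * (d - η * d) < ε * inner ℝ (x - q) u := by gcongr; linarith
  have h2 : d ^ 2 ≤ ‖x - q‖ ^ 2 := by gcongr
  have h3 : ((1 - η) * ε) ^ 2 ≤ ε ^ 2 :=
    pow_le_pow_left₀ (mul_nonneg (by linarith) hε.le)
      (mul_le_of_le_one_left hε.le (by linarith)) 2
  nlinarith

/-- If nearest points are unique at distance less than `R` from `M`, then the distance to `M`
grows at full rate in some direction. -/
theorem exists_dist_eq_infDist_ge [ProperSpace E] {M : Set E} (hM : IsCompact M) (hne : M.Nonempty)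
    {R : ℝ} (huniq : ∀ x, Metric.infDist x M < R → ∀ p ∈ M, ∀ q ∈ M,
      dist x p = Metric.infDist x M → dist x q = Metric.infDist x M → q = p)
    {x₀ : E} (hpos : 0 < Metric.infDist x₀ M) {s : ℝ} (hs : 0 ≤ s)
    (hsR : Metric.infDist x₀ M + s < R) :
    ∃ x, dist x x₀ = s ∧ Metric.infDist x₀ M + s ≤ Metric.infDist x M := by
  have key : ∀ η : ℝ, 0 < η → η ≤ 1 →
      ∃ x ∈ Metric.sphere x₀ s, Metric.infDist x₀ M + (1 - η) * s ≤ Metric.infDist x M := by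
    intro η hη hη1
    -- A maximum of this penalized distance cannot be interior: moving away from the nearest point
    -- would increase it. Compactness thus replaces following the gradient flow of the distance.
    obtain ⟨x, hx, hmax⟩ := (isCompact_closedBall x₀ s).exists_isMaxOn
      ⟨x₀, Metric.mem_closedBall_self hs⟩
      (f := fun x => Metric.infDist x M - (1 - η) * dist x x₀)
      ((Metric.continuous_infDist_pt M).sub (by fun_prop)).continuousOn
    have h0 := hmax (Metric.mem_closedBall_self hs)
    simp only [Set.mem_ofPred_eq, dist_self, mul_zero, sub_zero] at h0
    have hη' : 0 ≤ (1 - η) * dist x x₀ := mul_nonneg (by linarith) dist_nonneg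
    rw [Metric.mem_closedBall] at hx
    rcases hx.lt_or_eq with hlt | heq
    · exfalso
      obtain ⟨p, hp, hxp⟩ := hM.exists_infDist_eq_dist hne x
      have hdx : Metric.infDist x M ≤ Metric.infDist x₀ M + dist x x₀ :=
        Metric.infDist_le_infDist_add_dist
      have hposx : 0 < Metric.infDist x M := by linarith
      obtain ⟨r, hr, hgrow⟩ := eventually_infDist_growth hM hp hxp.symm
        (fun q hq h => huniq x (by linarith) p hp q hq hxp.symm h) hposx hη hη1
      set ε := min (r / 2) (s - dist x x₀) with hε
      have hε0 : 0 < ε := lt_min (by linarith) (by linarith)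
      have hg := hgrow ε hε0 ((min_le_left _ _).trans_lt (by linarith))
      set y := x + ε • ((Metric.infDist x M)⁻¹ • (x - p)) with hy
      have hyx : dist y x = ε := by
        rw [hy, dist_eq_norm, add_sub_cancel_left, norm_smul, norm_smul, ← dist_eq_norm, ← hxp,
          norm_inv, Real.norm_of_nonneg hposx.le, inv_mul_cancel₀ hposx.ne',
          Real.norm_of_nonneg hε0.le, mul_one]
      have hyx₀ : dist y x₀ ≤ ε + dist x x₀ := hyx ▸ dist_triangle y x x₀
      have hεs : ε ≤ s - dist x x₀ := min_le_right _ _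
      have hm := hmax (Metric.mem_closedBall.2 (by linarith : dist y x₀ ≤ s))
      simp only [Set.mem_ofPred_eq] at hm
      have : (1 - η) * dist y x₀ ≤ (1 - η) * (ε + dist x x₀) :=
        mul_le_mul_of_nonneg_left hyx₀ (by linarith)
      linarith
    · refine ⟨x, heq, ?_⟩
      rw [heq] at h0
      linarith
  obtain ⟨x₁, hx₁, -⟩ := key 1 one_pos le_rfl
  obtain ⟨x, hx, hmax⟩ := (isCompact_sphere x₀ s).exists_isMaxOn ⟨x₁, hx₁⟩
    (f := fun x => Metric.infDist x M) (Metric.continuous_infDist_pt M).continuousOn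
  refine ⟨x, hx, le_of_forall_pos_le_add fun δ hδ => ?_⟩
  -- The choice makes the loss `η * s` at most `δ`; `s + 1` keeps the denominator positive when `s =
  -- 0`.
  obtain ⟨y, hy, hle⟩ := key (min 1 (δ / (s + 1))) (lt_min one_pos (by positivity)) (min_le_left _ _)
  have h1 : Metric.infDist y M ≤ Metric.infDist x M := hmax hy
  have h2 : min 1 (δ / (s + 1)) * s ≤ δ := by
    calc min 1 (δ / (s + 1)) * s ≤ δ / (s + 1) * (s + 1) := by
          gcongr
          · exact min_le_right _ _
          · linarith
      _ = δ := by field_simp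
  linarith

/-- If nearest points are unique at distance less than `R` from `M`, then a nearest point of `x₀`
remains nearest along the normal ray, up to distance `R`. -/
theorem le_infDist_normal_ray [ProperSpace E] {M : Set E} (hM : IsCompact M)
    {R : ℝ} (huniq : ∀ x, Metric.infDist x M < R → ∀ p ∈ M, ∀ q ∈ M,
      dist x p = Metric.infDist x M → dist x q = Metric.infDist x M → q = p)
    {x₀ p : E} (hp : p ∈ M) (hxp : dist x₀ p = Metric.infDist x₀ M)
    (hpos : 0 < Metric.infDist x₀ M) (hR : Metric.infDist x₀ M < R) :
    R ≤ Metric.infDist (p + R • ((Metric.infDist x₀ M)⁻¹ • (x₀ - p))) M := by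
  set d := Metric.infDist x₀ M with hd
  have hn : ‖x₀ - p‖ = d := by rw [← dist_eq_norm, hxp]
  have key : ∀ t ∈ Set.Ico d R, t ≤ Metric.infDist (p + t • (d⁻¹ • (x₀ - p))) M := by
    rintro t ⟨hdt, htR⟩
    obtain ⟨x, hx, hle⟩ := exists_dist_eq_infDist_ge hM ⟨p, hp⟩ huniq hpos (sub_nonneg.2 hdt)
      (by linarith)
    rw [dist_eq_norm] at hx
    have h1 : t ≤ ‖x - p‖ := by
      have := Metric.infDist_le_dist_of_mem (x := x) hp
      rw [dist_eq_norm] at this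
      linarith
    have h2 : ‖x - p‖ ^ 2 = ‖x - x₀‖ ^ 2 + 2 * inner ℝ (x - x₀) (x₀ - p) + ‖x₀ - p‖ ^ 2 := by
      rw [← norm_add_sq_real, sub_add_sub_cancel]
    have h3 : t ^ 2 ≤ ‖x - p‖ ^ 2 := by
      have : 0 ≤ t := by linarith
      gcongr
    rw [hx, hn] at h2
    have h4 : (t - d) * d ≤ inner ℝ (x - x₀) (x₀ - p) := by nlinarith
    -- Equality case of the triangle inequality: `x` is at distance `t - d` from `x₀` and at least
    -- `t` from `p`, so it is the point of the ray with parameter `t`.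
    have h5 : ‖(x - x₀) - (t - d) • (d⁻¹ • (x₀ - p))‖ ^ 2 ≤ 0 := by
      rw [norm_sub_sq_real, hx, inner_smul_right, inner_smul_right, norm_smul, norm_smul, hn,
        norm_inv, Real.norm_of_nonneg hpos.le, inv_mul_cancel₀ hpos.ne', mul_one,
        Real.norm_of_nonneg (sub_nonneg.2 hdt)]
      have h6 : (t - d) * (d⁻¹ * ((t - d) * d)) ≤ (t - d) * (d⁻¹ * inner ℝ (x - x₀) (x₀ - p)) := by
        have := sub_nonneg.2 hdt
        gcongr
      have h7 : (t - d) * (d⁻¹ * ((t - d) * d)) = (t - d) ^ 2 := by field_simp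
      linarith
    have h6 : (x - x₀) - (t - d) • (d⁻¹ • (x₀ - p)) = 0 := by
      rw [← norm_eq_zero]
      exact pow_eq_zero_iff (two_ne_zero) |>.1 (le_antisymm h5 (sq_nonneg _))
    have h7 : p + t • (d⁻¹ • (x₀ - p)) = x := by
      have h8 : d • (d⁻¹ • (x₀ - p)) = x₀ - p := smul_inv_smul₀ hpos.ne' _
      rw [sub_smul, h8] at h6
      rw [← sub_eq_zero, ← neg_eq_zero, ← h6]
      abel
    rw [h7]
    linarith
  -- The growth lemma requires `t < R`; the value `R` itself is reached by continuity.
  have hcl : IsClosed {t : ℝ | t ≤ Metric.infDist (p + t • (d⁻¹ • (x₀ - p))) M} :=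
    isClosed_le continuous_id ((Metric.continuous_infDist_pt M).comp (by fun_prop))
  have := closure_minimal key hcl
  rw [closure_Ico hR.ne] at this
  exact this ⟨hR.le, le_rfl⟩

/-- Let `M` lie outside the open ball of centre `z` and radius `R`, with unique nearest points at
distance less than `R`. If `a` and `b` are points of `M` on the bounding sphere, not antipodal, then
the midpoint of the shorter arc from `a` to `b` belongs to `M`. -/
theorem arc_midpoint_mem [ProperSpace E] {M : Set E} (hM : IsCompact M)
    {R : ℝ} (huniq : ∀ x, Metric.infDist x M < R → ∀ p ∈ M, ∀ q ∈ M,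
      dist x p = Metric.infDist x M → dist x q = Metric.infDist x M → q = p)
    {z a b w : E} {k : ℝ} (hz : ∀ p ∈ M, R ≤ ‖p - z‖) (ha : a ∈ M) (hb : b ∈ M)
    (haz : ‖a - z‖ = R) (hbz : ‖b - z‖ = R) (hk : 0 < k) (hw : ‖w‖ = R)
    (hab : (1 / 2 : ℝ) • (a + b) - z = k • w) : z + w ∈ M := by
  have hR : 0 ≤ R := haz ▸ norm_nonneg _
  set c := (1 / 2 : ℝ) • (a + b) with hc
  have hcz : ‖c - z‖ = k * R := by rw [hab, norm_smul, hw, Real.norm_of_nonneg hk.le]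
  have hpar : ∀ y, ‖a - y‖ ^ 2 + ‖b - y‖ ^ 2 = 2 * ‖c - y‖ ^ 2 + ‖a - b‖ ^ 2 / 2 := by
    intro y
    have h1 := parallelogram_law_with_norm ℝ (a - y) (b - y)
    have h2 : (a - y) + (b - y) = (2 : ℝ) • (c - y) := by rw [hc]; module
    have h3 : (a - y) - (b - y) = a - b := by abel
    rw [h2, h3, norm_smul, Real.norm_ofNat] at h1
    nlinarith
  have hzp := hpar z
  rw [haz, hbz, hcz] at hzp
  have hca : ‖c - a‖ = ‖a - b‖ / 2 := by
    have : c - a = (-1 / 2 : ℝ) • (a - b) := by rw [hc]; module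
    rw [this, norm_smul]
    norm_num
    ring
  obtain ⟨p, hp, hcp⟩ := hM.exists_infDist_eq_dist ⟨a, ha⟩ c
  have hpz := hz p hp
  have htri : ‖p - z‖ ≤ ‖p - c‖ + ‖c - z‖ := norm_sub_le_norm_sub_add_norm_sub _ _ _
  rw [hcz] at htri
  rcases hR.eq_or_lt with hR0 | hR0
  · have hw0 : w = 0 := norm_eq_zero.1 (hw.trans hR0.symm)
    have ha0 : a = z := by rw [← sub_eq_zero, ← norm_eq_zero, haz, hR0]
    rwa [hw0, add_zero, ← ha0]
  have hdR : Metric.infDist c M < R := by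
    have h1 : Metric.infDist c M ≤ ‖a - b‖ / 2 := by
      rw [← hca, ← dist_eq_norm]; exact Metric.infDist_le_dist_of_mem ha
    have h2 : (‖a - b‖ / 2) ^ 2 < R ^ 2 := by nlinarith [mul_pos hk hR0]
    have := lt_of_pow_lt_pow_left₀ 2 hR h2
    linarith
  set h := Metric.infDist c M with hh
  have hpc : ‖p - c‖ = h := by rw [norm_sub_rev, ← dist_eq_norm, hcp]
  have hle : h ≤ R - k * R := by
    -- If `h = 0` there is no normal direction, and the bound reduces to `k ≤ 1`.
    rcases (Metric.infDist_nonneg (x := c) (s := M)).eq_or_lt with h0 | h0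
    · rw [← hh] at h0
      have : k ≤ 1 := by
        have h1 : (k * R) ^ 2 ≤ R ^ 2 := by nlinarith [sq_nonneg ‖a - b‖]
        have h2 := le_of_sq_le_sq h1 hR
        nlinarith
      nlinarith
    · have hray := le_infDist_normal_ray hM huniq hp hcp.symm h0 hdR
      rw [← hh] at hray h0
      set y := p + R • (h⁻¹ • (c - p)) with hy
      have h1 : R ≤ ‖a - y‖ := by
        rw [norm_sub_rev, ← dist_eq_norm]; exact hray.trans (Metric.infDist_le_dist_of_mem ha)
      have h2 : R ≤ ‖b - y‖ := by
        rw [norm_sub_rev, ← dist_eq_norm]; exact hray.trans (Metric.infDist_le_dist_of_mem hb)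
      have h3 : ‖c - y‖ = R - h := by
        have : c - y = ((R - h) * h⁻¹) • (p - c) := by
          have h8 : h • (h⁻¹ • (p - c)) = p - c := smul_inv_smul₀ h0.ne' _
          rw [sub_mul, sub_smul, mul_smul, mul_smul, h8, hy]
          module
        rw [this, norm_smul, norm_mul, hpc, norm_inv, Real.norm_of_nonneg h0.le,
          Real.norm_of_nonneg (by linarith), mul_assoc, inv_mul_cancel₀ h0.ne', mul_one]
      have h4 := hpar y
      rw [h3] at h4
      have h5 : R ^ 2 ≤ ‖a - y‖ ^ 2 := by gcongr
      have h6 : R ^ 2 ≤ ‖b - y‖ ^ 2 := by gcongr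
      have h7 : (k * R) ^ 2 ≤ (R - h) ^ 2 := by nlinarith
      have h8 := le_of_sq_le_sq h7 (by linarith)
      linarith
  have hpz' : ‖p - z‖ = R := by linarith
  have hheq : h = R - k * R := by linarith
  -- The triangle inequality through `c` is now an equality, so `p - z` is the vector of norm `R` in
  -- the direction of `w`.
  have hsq : ‖(p - z) - w‖ ^ 2 = 0 := by
    have h1 : ‖(p - z) - k • w‖ ^ 2 = (R - k * R) ^ 2 := by
      rw [← hab, sub_sub_sub_cancel_right, hpc, hheq]
    rw [norm_sub_sq_real, inner_smul_right, norm_smul, hw, hpz', Real.norm_of_nonneg hk.le] at h1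
    have h2 : k * inner ℝ (p - z) w = k * R ^ 2 := by nlinarith
    have h3 := mul_left_cancel₀ hk.ne' h2
    rw [norm_sub_sq_real, hpz', hw, h3]
    ring
  have : p = z + w := by
    have h1 := norm_eq_zero.1 (pow_eq_zero_iff two_ne_zero |>.1 hsq)
    rw [← sub_eq_zero, ← h1]
    abel
  exact this ▸ hp

end Projection

/-! ### Length of paths on the unit sphere, and radial projection -/

section SphericalPaths

variable {E : Type*} [NormedAddCommGroup E] [InnerProductSpace ℝ E]

open InnerProductGeometry Filter Topology

/-- Expressing the angle by the chord makes it continuous along a path and equal to the chord to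
first order at zero. -/
theorem angle_eq_two_mul_arcsin {x y : E} (hx : ‖x‖ = 1) (hy : ‖y‖ = 1) :
    angle x y = 2 * Real.arcsin (‖x - y‖ / 2) := by
  have h0 := angle_nonneg x y
  have hπ := angle_le_pi x y
  have hsin : ‖x - y‖ / 2 = Real.sin (angle x y / 2) := by
    have h1 : 0 ≤ Real.sin (angle x y / 2) :=
      Real.sin_nonneg_of_nonneg_of_le_pi (by linarith) (by linarith)
    refine (sq_eq_sq₀ (by positivity) h1).1 ?_
    rw [div_pow, norm_sub_sq_real, hx, hy, inner_eq_cos_angle_of_norm_eq_one hx hy,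
      Real.sin_sq_eq_half_sub, mul_div_cancel₀ _ (two_ne_zero)]
    ring
  rw [hsin, Real.arcsin_sin (by linarith) (by linarith)]
  ring

/-- The angle between the endpoints of a path on the unit sphere is at most its length. -/
theorem angle_le_integral_norm_deriv {u u' : ℝ → E} {a b : ℝ} (hab : a ≤ b)
    (hu : ∀ t ∈ Set.Icc a b, HasDerivWithinAt u (u' t) (Set.Icc a b) t)
    (hu' : ContinuousOn u' (Set.Icc a b)) (hnorm : ∀ t ∈ Set.Icc a b, ‖u t‖ = 1) :
    angle (u a) (u b) ≤ ∫ t in a..b, ‖u' t‖ := by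
  have hucont : ContinuousOn u (Set.Icc a b) := fun t ht => (hu t ht).continuousWithinAt
  have hint : IntervalIntegrable (fun t => ‖u' t‖) MeasureTheory.volume a b :=
    hu'.norm.intervalIntegrable_of_Icc hab
  -- Comparison of Dini derivatives: the angle need not be differentiable in `t`, but its right
  -- slopes are bounded by those of the angle from `u x` to `u z`, by the triangle inequality for
  -- angles.
  refine image_le_of_liminf_slope_right_le_deriv_boundary (f := fun t => angle (u a) (u t))
    (B := fun t => ∫ s in a..t, ‖u' s‖) (B' := fun t => ‖u' t‖) (a := a) (b := b)
    ?_ ?_ ?_ ?_ ?_ (Set.right_mem_Icc.2 hab)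
  · have hEq : Set.EqOn (fun t => angle (u a) (u t))
        (fun t => 2 * Real.arcsin (‖u a - u t‖ / 2)) (Set.Icc a b) := fun t ht =>
      angle_eq_two_mul_arcsin (hnorm a (Set.left_mem_Icc.2 hab)) (hnorm t ht)
    refine ContinuousOn.congr ?_ hEq
    exact continuousOn_const.mul (Real.continuous_arcsin.comp_continuousOn
      ((continuousOn_const.sub hucont).norm.div_const 2))
  · have h1 : u a ≠ 0 := by
      rw [← norm_ne_zero_iff, hnorm a (Set.left_mem_Icc.2 hab)]; exact one_ne_zero
    simp [angle_self h1]
  · exact (intervalIntegral.continuousOn_primitive_interval' hint Set.left_mem_uIcc).mono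
      Set.Icc_subset_uIcc
  · intro x hx
    have hxI : x ∈ Set.Icc a b := ⟨hx.1, hx.2.le⟩
    have hnhds : Set.Icc a b ∈ 𝓝[>] x := mem_of_superset (Ioc_mem_nhdsGT hx.2)
      fun y hy => ⟨hx.1.trans hy.1.le, hy.2⟩
    have hle : 𝓝[>] x ≤ 𝓝[Set.Icc a b] x :=
      le_inf inf_le_left (le_principal_iff.2 hnhds)
    refine intervalIntegral.integral_hasDerivWithinAt_right
      (hint.mono_set (Set.uIcc_subset_uIcc Set.left_mem_uIcc
        (Set.Icc_subset_uIcc hxI))) (t := Set.Ioi x) ?_ ?_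
    · exact ⟨Set.Icc a b, hnhds, hu'.norm.aestronglyMeasurable measurableSet_Icc⟩
    · exact (hu'.norm x hxI).mono_left hle
  · intro x hx r hr
    have hxI : x ∈ Set.Icc a b := ⟨hx.1, hx.2.le⟩
    have hnhds : Set.Icc a b ∈ 𝓝[>] x := mem_of_superset (Ioc_mem_nhdsGT hx.2)
      fun y hy => ⟨hx.1.trans hy.1.le, hy.2⟩
    have hux : HasDerivWithinAt u (u' x) (Set.Ioi x) x :=
      ((hu x hxI).mono_of_mem_nhdsWithin hnhds)
    have hdist : HasDerivWithinAt (fun z => ‖u x - u z‖ / 2) (‖u' x‖ / 2) (Set.Ioi x) x := by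
      rw [hasDerivWithinAt_iff_tendsto_slope' (by simp)] at hux ⊢
      refine (hux.norm.div_const 2).congr' ?_
      filter_upwards [self_mem_nhdsWithin] with z hz
      have hz' : 0 < z - x := sub_pos.2 hz
      rw [slope_def_module, slope_def_field, norm_smul, norm_inv, Real.norm_of_nonneg hz'.le,
        norm_sub_rev (u x)]
      simp
      field_simp
    have harc : HasDerivAt Real.arcsin 1 (‖u x - u x‖ / 2) := by
      have := Real.hasDerivAt_arcsin (x := 0) (by norm_num) (by norm_num)
      simpa using this
    have hcomp := ((harc.comp_hasDerivWithinAt x hdist).const_mul 2)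
    rw [hasDerivWithinAt_iff_tendsto_slope' (by simp)] at hcomp
    have hlim : 2 * (1 * (‖u' x‖ / 2)) < r := by linarith
    refine Eventually.frequently ?_
    filter_upwards [hcomp.eventually_lt_const hlim, hnhds, self_mem_nhdsWithin] with z hz hzI hxz
    refine lt_of_le_of_lt ?_ hz
    have hz' : 0 < z - x := sub_pos.2 hxz
    rw [slope_def_field, slope_def_field]
    refine div_le_div_of_nonneg_right ?_ hz'.le
    simp only [Function.comp_apply, sub_self, norm_zero, zero_div, Real.arcsin_zero, mul_zero,
      sub_zero]
    rw [← angle_eq_two_mul_arcsin (hnorm x hxI) (hnorm z hzI)]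
    linarith [angle_le_angle_add_angle (u a) (u x) (u z)]

theorem norm_cos_smul_add_sin_smul {e₁ e₂ : E} (h₁ : ‖e₁‖ = 1) (h₂ : ‖e₂‖ = 1) (h₁₂ : inner ℝ e₁ e₂ = 0)
    (x : ℝ) : ‖Real.cos x • e₁ + Real.sin x • e₂‖ = 1 := by
  refine (pow_eq_one_iff_of_nonneg (norm_nonneg _) two_ne_zero).1 ?_
  rw [norm_add_sq_real, inner_smul_left, inner_smul_right, h₁₂, norm_smul, norm_smul, h₁, h₂]
  simp [Real.cos_sq_add_sin_sq]

/-- A unit vector on the minimizing great circle arc from `e₁` to `cos θ e₁ + sin θ e₂` is determined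
by its angles to the endpoints. -/
theorem eq_cos_smul_add_sin_smul {u e₁ e₂ : E} {θ s : ℝ} (hu : ‖u‖ = 1) (h₁ : ‖e₁‖ = 1)
    (h₂ : ‖e₂‖ = 1) (h₁₂ : inner ℝ e₁ e₂ = 0) (hθ : Real.sin θ ≠ 0) (hs : angle e₁ u = s)
    (hs' : angle u (Real.cos θ • e₁ + Real.sin θ • e₂) = θ - s) :
    u = Real.cos s • e₁ + Real.sin s • e₂ := by
  have hn := norm_cos_smul_add_sin_smul h₁ h₂ h₁₂ θ
  have hi₁ : inner ℝ u e₁ = Real.cos s := by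
    rw [real_inner_comm, inner_eq_cos_angle_of_norm_eq_one h₁ hu, hs]
  have hi₂ : inner ℝ u e₂ = Real.sin s := by
    have h := inner_eq_cos_angle_of_norm_eq_one hu hn
    rw [hs', inner_add_right, inner_smul_right, inner_smul_right, hi₁, Real.cos_sub] at h
    exact mul_left_cancel₀ hθ (by linarith)
  have : ‖u - (Real.cos s • e₁ + Real.sin s • e₂)‖ ^ 2 = 0 := by
    rw [norm_sub_sq_real, norm_cos_smul_add_sin_smul h₁ h₂ h₁₂, hu, inner_add_right, inner_smul_right, inner_smul_right, hi₁, hi₂]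
    linarith [Real.cos_sq_add_sin_sq s]
  exact sub_eq_zero.1 (norm_eq_zero.1 (pow_eq_zero_iff two_ne_zero |>.1 this))

/-- The derivative of the radial projection of a path to the unit sphere. -/
theorem hasDerivWithinAt_inv_norm_smul {c : ℝ → E} {c' : E} {s : Set ℝ} {t : ℝ}
    (hc : HasDerivWithinAt c c' s t) (h0 : c t ≠ 0) :
    HasDerivWithinAt (fun t => ‖c t‖⁻¹ • c t)
      (‖c t‖⁻¹ • (c' - (inner ℝ (c t) c' / ‖c t‖ ^ 2) • c t)) s t := by
  have hn : ‖c t‖ ≠ 0 := norm_ne_zero_iff.2 h0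
  have h1 : HasDerivWithinAt (fun t => ‖c t‖) (inner ℝ (c t) c' / ‖c t‖) s t := by
    have h2 := (hc.norm_sq).sqrt (pow_ne_zero 2 hn)
    simp only [Real.sqrt_sq (norm_nonneg _)] at h2
    convert h2 using 1
    field_simp
  refine ((h1.inv hn).smul hc).congr_deriv ?_
  rw [smul_sub, smul_smul, sub_eq_add_neg, ← neg_smul]
  congr 2
  field_simp

/-- Pythagoras: the bracket is the component of `v` orthogonal to `x`, and the factor `‖x‖⁻¹`
cancels against `‖x‖ ^ 2`. -/
theorem norm_sq_deriv_inv_norm_smul {x v : E} (hx : x ≠ 0) :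
    ‖x‖ ^ 2 * ‖‖x‖⁻¹ • (v - (inner ℝ x v / ‖x‖ ^ 2) • x)‖ ^ 2 =
      ‖v‖ ^ 2 - inner ℝ x v ^ 2 / ‖x‖ ^ 2 := by
  have hn : ‖x‖ ≠ 0 := norm_ne_zero_iff.2 hx
  rw [norm_smul, mul_pow, norm_inv, norm_norm, norm_sub_sq_real, inner_smul_right, norm_smul,
    mul_pow, Real.norm_eq_abs, sq_abs, real_inner_comm x v]
  field_simp
  ring

end SphericalPaths

/-! ### Paths outside a ball: length bound and equality case -/

section OutsideBall

variable {E : Type*} [NormedAddCommGroup E] [InnerProductSpace ℝ E]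

open InnerProductGeometry

variable {x x' : ℝ → E} {a b R : ℝ}

theorem mul_norm_deriv_inv_norm_smul_le {y v : E} (hR : 0 < R) (hy : R ≤ ‖y‖) :
    R * ‖‖y‖⁻¹ • (v - (inner ℝ y v / ‖y‖ ^ 2) • y)‖ ≤ ‖v‖ := by
  have hy0 : y ≠ 0 := norm_pos_iff.1 (hR.trans_le hy)
  have h := norm_sq_deriv_inv_norm_smul (v := v) hy0
  rw [← mul_pow] at h
  have h2 : 0 ≤ inner ℝ y v ^ 2 / ‖y‖ ^ 2 := by positivity
  refine (mul_le_mul_of_nonneg_right hy (norm_nonneg _)).trans ?_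
  exact le_of_sq_le_sq (by linarith) (norm_nonneg _)

/-- Equality leaves no room for the radial term that the length bound discards. -/
theorem inner_eq_zero_of_mul_norm_eq {y v : E} (hR : 0 < R) (hy : R ≤ ‖y‖)
    (h : R * ‖‖y‖⁻¹ • (v - (inner ℝ y v / ‖y‖ ^ 2) • y)‖ = ‖v‖) : inner ℝ y v = 0 := by
  have hy0 : y ≠ 0 := norm_pos_iff.1 (hR.trans_le hy)
  have h1 := norm_sq_deriv_inv_norm_smul (v := v) hy0
  rw [← mul_pow] at h1
  have h2 := pow_le_pow_left₀ (by positivity) (mul_le_mul_of_nonneg_right hy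
    (norm_nonneg (‖y‖⁻¹ • (v - (inner ℝ y v / ‖y‖ ^ 2) • y)))) 2
  rw [h, h1] at h2
  have hpos : 0 < ‖y‖ ^ 2 := pow_pos (norm_pos_iff.2 hy0) 2
  have h3 : inner ℝ y v ^ 2 / ‖y‖ ^ 2 ≤ 0 := by linarith
  rw [div_le_iff₀ hpos, zero_mul] at h3
  exact pow_eq_zero_iff two_ne_zero |>.1 (le_antisymm h3 (sq_nonneg _))

theorem continuousOn_deriv_inv_norm_smul {s : Set ℝ} (hx : ContinuousOn x s)
    (hx' : ContinuousOn x' s) (h0 : ∀ t ∈ s, x t ≠ 0) :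
    ContinuousOn (fun t => ‖x t‖⁻¹ • (x' t - (inner ℝ (x t) (x' t) / ‖x t‖ ^ 2) • x t)) s :=
  (hx.norm.inv₀ fun t ht => norm_ne_zero_iff.2 (h0 t ht)).smul
    (hx'.sub (((hx.inner hx').div (hx.norm.pow 2)
      fun t ht => pow_ne_zero 2 (norm_ne_zero_iff.2 (h0 t ht))).smul hx))

theorem angle_le_integral_norm_deriv_inv_norm_smul (hab : a ≤ b) (hR : 0 < R)
    (hx : ∀ t ∈ Set.Icc a b, HasDerivWithinAt x (x' t) (Set.Icc a b) t)
    (hx' : ContinuousOn x' (Set.Icc a b)) (hout : ∀ t ∈ Set.Icc a b, R ≤ ‖x t‖) :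
    angle (x a) (x b) ≤
      ∫ t in a..b, ‖‖x t‖⁻¹ • (x' t - (inner ℝ (x t) (x' t) / ‖x t‖ ^ 2) • x t)‖ := by
  have h0 : ∀ t ∈ Set.Icc a b, x t ≠ 0 := fun t ht => norm_pos_iff.1 (hR.trans_le (hout t ht))
  have h := angle_le_integral_norm_deriv hab
    (fun t ht => hasDerivWithinAt_inv_norm_smul (hx t ht) (h0 t ht))
    (continuousOn_deriv_inv_norm_smul (fun t ht => (hx t ht).continuousWithinAt) hx' h0)
    (fun t ht => by rw [norm_smul, norm_inv, norm_norm,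
      inv_mul_cancel₀ (norm_ne_zero_iff.2 (h0 t ht))])
  rwa [angle_smul_left_of_pos _ _ (inv_pos.2 (norm_pos_iff.2 (h0 a (Set.left_mem_Icc.2 hab)))),
    angle_smul_right_of_pos _ _ (inv_pos.2 (norm_pos_iff.2 (h0 b (Set.right_mem_Icc.2 hab))))] at h

/-- A path outside the ball of radius `R` centred at the origin is at least as long as the arc of
radius `R` between the directions of its endpoints. -/
theorem mul_angle_le_integral_norm_deriv (hab : a ≤ b) (hR : 0 < R)
    (hx : ∀ t ∈ Set.Icc a b, HasDerivWithinAt x (x' t) (Set.Icc a b) t)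
    (hx' : ContinuousOn x' (Set.Icc a b)) (hout : ∀ t ∈ Set.Icc a b, R ≤ ‖x t‖) :
    R * angle (x a) (x b) ≤ ∫ t in a..b, ‖x' t‖ := by
  have h0 : ∀ t ∈ Set.Icc a b, x t ≠ 0 := fun t ht => norm_pos_iff.1 (hR.trans_le (hout t ht))
  refine (mul_le_mul_of_nonneg_left
    (angle_le_integral_norm_deriv_inv_norm_smul hab hR hx hx' hout) hR.le).trans ?_
  rw [← intervalIntegral.integral_const_mul]
  refine intervalIntegral.integral_mono_on hab ?_ (hx'.norm.intervalIntegrable_of_Icc hab)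
    fun t ht => mul_norm_deriv_inv_norm_smul_le hR (hout t ht)
  exact (continuousOn_const.mul (continuousOn_deriv_inv_norm_smul
    (fun t ht => (hx t ht).continuousWithinAt) hx' h0).norm).intervalIntegrable_of_Icc hab

/-- A path outside the ball of radius `R` that realizes the minimal length stays on the sphere. -/
theorem norm_eq_of_integral_norm_deriv_le (hab : a < b) (hR : 0 < R)
    (hx : ∀ t ∈ Set.Icc a b, HasDerivWithinAt x (x' t) (Set.Icc a b) t)
    (hx' : ContinuousOn x' (Set.Icc a b)) (hout : ∀ t ∈ Set.Icc a b, R ≤ ‖x t‖)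
    (hlen : ∫ t in a..b, ‖x' t‖ ≤ R * angle (x a) (x b)) :
    ∀ t ∈ Set.Icc a b, ‖x t‖ = ‖x a‖ := by
  have h0 : ∀ t ∈ Set.Icc a b, x t ≠ 0 := fun t ht => norm_pos_iff.1 (hR.trans_le (hout t ht))
  have horth : ∀ t ∈ Set.Icc a b, inner ℝ (x t) (x' t) = 0 := by
    intro t ht
    refine inner_eq_zero_of_mul_norm_eq hR (hout t ht)
      (le_antisymm (mul_norm_deriv_inv_norm_smul_le hR (hout t ht)) ?_)
    -- By continuity, strictness at a single time would make the integral inequality strict.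
    by_contra! hlt
    have h1 := intervalIntegral.integral_lt_integral_of_continuousOn_of_le_of_exists_lt hab
      (continuousOn_const.mul (continuousOn_deriv_inv_norm_smul
        (fun t ht => (hx t ht).continuousWithinAt) hx' h0).norm) hx'.norm
      (fun t ht => mul_norm_deriv_inv_norm_smul_le hR (hout t (Set.Ioc_subset_Icc_self ht)))
      ⟨t, ht, hlt⟩
    simp only [Pi.mul_apply] at h1
    rw [intervalIntegral.integral_const_mul] at h1
    have h2 := mul_le_mul_of_nonneg_left
      (angle_le_integral_norm_deriv_inv_norm_smul hab.le hR hx hx' hout) hR.le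
    linarith
  intro t ht
  have hsq : ‖x t‖ ^ 2 = ‖x a‖ ^ 2 := by
    refine constant_of_has_deriv_right_zero (f := fun t => ‖x t‖ ^ 2)
      (fun t ht => (hx t ht).norm_sq.continuousWithinAt) (fun t ht => ?_) t ht
    have htI : t ∈ Set.Icc a b := ⟨ht.1, ht.2.le⟩
    have h1 := (hx t htI).norm_sq
    rw [horth t htI, mul_zero] at h1
    exact h1.mono_of_mem_nhdsWithin (Filter.mem_of_superset (Icc_mem_nhdsGE ht.2)
      fun y hy => ⟨ht.1.trans hy.1, hy.2⟩)
  exact (sq_eq_sq₀ (norm_nonneg _) (norm_nonneg _)).1 hsq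

/-- A path outside the ball of radius `R` that realizes the minimal length minimizes length between
any of its points and its endpoints. -/
theorem angle_eq_of_integral_norm_deriv_le (hR : 0 < R)
    (hx : ∀ t ∈ Set.Icc a b, HasDerivWithinAt x (x' t) (Set.Icc a b) t)
    (hx' : ContinuousOn x' (Set.Icc a b)) (hout : ∀ t ∈ Set.Icc a b, R ≤ ‖x t‖)
    (hlen : ∫ t in a..b, ‖x' t‖ ≤ R * angle (x a) (x b)) {t : ℝ} (ht : t ∈ Set.Icc a b) :
    angle (x a) (x t) = (∫ s in a..t, ‖x' s‖) / R ∧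
      angle (x t) (x b) = angle (x a) (x b) - (∫ s in a..t, ‖x' s‖) / R := by
  have hl : Set.Icc a t ⊆ Set.Icc a b := Set.Icc_subset_Icc_right ht.2
  have hr : Set.Icc t b ⊆ Set.Icc a b := Set.Icc_subset_Icc_left ht.1
  have h1 := mul_angle_le_integral_norm_deriv ht.1 hR (fun s hs => (hx s (hl hs)).mono hl)
    (hx'.mono hl) (fun s hs => hout s (hl hs))
  have h2 := mul_angle_le_integral_norm_deriv ht.2 hR (fun s hs => (hx s (hr hs)).mono hr)
    (hx'.mono hr) (fun s hs => hout s (hr hs))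
  have h3 := intervalIntegral.integral_add_adjacent_intervals
    ((hx'.mono hl).norm.intervalIntegrable_of_Icc (μ := MeasureTheory.volume) ht.1)
    ((hx'.mono hr).norm.intervalIntegrable_of_Icc (μ := MeasureTheory.volume) ht.2)
  -- The two partial bounds add up to at most the total length, hence to at most the full angle; the
  -- triangle inequality for angles makes all of them equalities.
  have h4 := mul_le_mul_of_nonneg_left (angle_le_angle_add_angle (x a) (x t) (x b)) hR.le
  rw [mul_add] at h4
  have h5 : angle (x a) (x t) * R = ∫ s in a..t, ‖x' s‖ := by linarith
  have h6 : angle (x a) (x t) = (∫ s in a..t, ‖x' s‖) / R := by rw [← h5]; field_simp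
  refine ⟨h6, ?_⟩
  rw [← h6]
  refine mul_left_cancel₀ hR.ne' ?_
  linarith

end OutsideBall

/-! ### The circle arc and its inclusion in `M` -/

section Arc

variable {E : Type*} [NormedAddCommGroup E] [InnerProductSpace ℝ E]

/-- The arc-length parametrization of the circle of centre `z` and radius `R` in the plane of the
orthonormal vectors `e₁` and `e₂`. -/
noncomputable def circleArc (z e₁ e₂ : E) (R t : ℝ) : E :=
  z + R • (Real.cos (t / R) • e₁ + Real.sin (t / R) • e₂)

variable {z e₁ e₂ : E} {R : ℝ}

theorem contDiff_circleArc (z e₁ e₂ : E) (R : ℝ) : ContDiff ℝ ∞ (circleArc z e₁ e₂ R) := by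
  unfold circleArc
  fun_prop

theorem deriv_circleArc (hR : R ≠ 0) :
    deriv (circleArc z e₁ e₂ R) =
      fun t => -Real.sin (t / R) • e₁ + Real.cos (t / R) • e₂ := by
  funext t
  have hd : HasDerivAt (fun t : ℝ => t / R) (1 / R) t := (hasDerivAt_id t).div_const R
  have := ((((hd.cos.smul_const e₁).add (hd.sin.smul_const e₂)).const_smul R).const_add z)
  refine (HasDerivAt.deriv (f := circleArc z e₁ e₂ R) this).trans ?_
  rw [smul_add, smul_smul, smul_smul]
  congr 2 <;> field_simp

theorem deriv_deriv_circleArc (hR : R ≠ 0) :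
    deriv (deriv (circleArc z e₁ e₂ R)) =
      fun t => (-(1 / R)) • (Real.cos (t / R) • e₁ + Real.sin (t / R) • e₂) := by
  funext t
  rw [deriv_circleArc hR]
  have hd : HasDerivAt (fun t : ℝ => t / R) (1 / R) t := (hasDerivAt_id t).div_const R
  refine ((hd.sin.neg.smul_const e₁).add (hd.cos.smul_const e₂)).deriv.trans ?_
  rw [smul_add, smul_smul, smul_smul]
  congr 2 <;> ring

theorem norm_deriv_circleArc (hR : R ≠ 0) (h₁ : ‖e₁‖ = 1) (h₂ : ‖e₂‖ = 1)
    (h₁₂ : inner ℝ e₁ e₂ = 0) (t : ℝ) : ‖deriv (circleArc z e₁ e₂ R) t‖ = 1 := by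
  rw [deriv_circleArc hR]
  have := norm_cos_smul_add_sin_smul h₁ h₂ h₁₂ (t / R + Real.pi / 2)
  rwa [Real.cos_add_pi_div_two, Real.sin_add_pi_div_two] at this

theorem norm_deriv_deriv_circleArc (hR : 0 < R) (h₁ : ‖e₁‖ = 1) (h₂ : ‖e₂‖ = 1)
    (h₁₂ : inner ℝ e₁ e₂ = 0) (t : ℝ) : ‖deriv (deriv (circleArc z e₁ e₂ R)) t‖ = 1 / R := by
  rw [deriv_deriv_circleArc hR.ne', norm_smul, norm_cos_smul_add_sin_smul h₁ h₂ h₁₂, norm_neg,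
    Real.norm_of_nonneg (by positivity), mul_one]

theorem norm_circleArc_sub (hR : 0 < R) (h₁ : ‖e₁‖ = 1) (h₂ : ‖e₂‖ = 1)
    (h₁₂ : inner ℝ e₁ e₂ = 0) (t : ℝ) : ‖circleArc z e₁ e₂ R t - z‖ = R := by
  rw [circleArc, add_sub_cancel_left, norm_smul, norm_cos_smul_add_sin_smul h₁ h₂ h₁₂,
    Real.norm_of_nonneg hR.le, mul_one]

/-- Sum-to-product formulas; the cosine of the half-angle is the factor `k` of `arc_midpoint_mem`.
-/
theorem midpoint_circleArc_sub (s t : ℝ) :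
    (1 / 2 : ℝ) • (circleArc z e₁ e₂ R s + circleArc z e₁ e₂ R t) - z =
      Real.cos ((t - s) / (2 * R)) • (circleArc z e₁ e₂ R ((s + t) / 2) - z) := by
  have hc : Real.cos (s / R) + Real.cos (t / R) =
      2 * (Real.cos ((t - s) / (2 * R)) * Real.cos ((s + t) / 2 / R)) := by
    have h := Real.cos_add_cos (t / R) (s / R)
    rw [show (t / R + s / R) / 2 = (s + t) / 2 / R by ring,
      show (t / R - s / R) / 2 = (t - s) / (2 * R) by ring] at h
    linarith
  have hs : Real.sin (s / R) + Real.sin (t / R) =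
      2 * (Real.cos ((t - s) / (2 * R)) * Real.sin ((s + t) / 2 / R)) := by
    have h := Real.sin_add_sin (t / R) (s / R)
    rw [show (t / R + s / R) / 2 = (s + t) / 2 / R by ring,
      show (t / R - s / R) / 2 = (t - s) / (2 * R) by ring] at h
    linarith
  have h1 : (1 / 2 : ℝ) • (circleArc z e₁ e₂ R s + circleArc z e₁ e₂ R t) - z =
      (R / 2) • ((Real.cos (s / R) + Real.cos (t / R)) • e₁ +
        (Real.sin (s / R) + Real.sin (t / R)) • e₂) := by
    unfold circleArc; module
  rw [h1, hc, hs]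
  unfold circleArc; module

/-- An arc of a circle of radius `R` outside of which the compact set `M` lies is contained in `M`
as soon as its endpoints are, if points at distance less than `R` from `M` have unique nearest
points. -/
theorem circleArc_mem [ProperSpace E] {M : Set E} (hM : IsCompact M)
    (huniq : ∀ x, Metric.infDist x M < R → ∀ p ∈ M, ∀ q ∈ M,
      dist x p = Metric.infDist x M → dist x q = Metric.infDist x M → q = p)
    (hz : ∀ p ∈ M, R ≤ ‖p - z‖) (hR : 0 < R) (h₁ : ‖e₁‖ = 1) (h₂ : ‖e₂‖ = 1)
    (h₁₂ : inner ℝ e₁ e₂ = 0) {ℓ : ℝ} (hℓ : ℓ < R * Real.pi)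
    (hstart : circleArc z e₁ e₂ R 0 ∈ M) (hend : circleArc z e₁ e₂ R ℓ ∈ M) :
    ∀ t ∈ Set.Icc 0 ℓ, circleArc z e₁ e₂ R t ∈ M := by
  intro t ht
  have hcl : IsClosed (circleArc z e₁ e₂ R ⁻¹' M) :=
    hM.isClosed.preimage (contDiff_circleArc z e₁ e₂ R).continuous
  -- The parameters `s ≤ t ≤ r` bound the gap of `M` around `t`. The arc midpoint between them lies
  -- in `M`, so by extremality one of them is `t`.
  obtain ⟨s, hs, hsmax⟩ := (isCompact_Icc.inter_left hcl).exists_isGreatest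
    (s := circleArc z e₁ e₂ R ⁻¹' M ∩ Set.Icc 0 t) ⟨0, hstart, le_rfl, ht.1⟩
  obtain ⟨r, hr, hrmin⟩ := (isCompact_Icc.inter_left hcl).exists_isLeast
    (s := circleArc z e₁ e₂ R ⁻¹' M ∩ Set.Icc t ℓ) ⟨ℓ, hend, ht.2, le_rfl⟩
  -- The half-angle is below `π / 2` because the arc is shorter than a half circle.
  have hcos : 0 < Real.cos ((r - s) / (2 * R)) := by
    refine Real.cos_pos_of_mem_Ioo ⟨?_, ?_⟩
    · have : 0 ≤ (r - s) / (2 * R) := by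
        have := hs.2.2.trans hr.2.1
        have := sub_nonneg.2 this
        positivity
      linarith [Real.pi_pos]
    · rw [div_lt_iff₀ (by positivity)]
      linarith [hs.2.1, hr.2.2]
  have hmid := arc_midpoint_mem hM huniq hz hs.1 hr.1 (norm_circleArc_sub hR h₁ h₂ h₁₂ s)
    (norm_circleArc_sub hR h₁ h₂ h₁₂ r) hcos (norm_circleArc_sub hR h₁ h₂ h₁₂ _)
    (midpoint_circleArc_sub s r)
  rw [add_sub_cancel] at hmid
  rcases le_total ((s + r) / 2) t with h | h
  · have := hsmax ⟨hmid, by linarith [hs.2.1, hr.2.1, ht.1], h⟩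
    have : s = t := le_antisymm hs.2.2 (by linarith [hr.2.1])
    exact this ▸ hs.1
  · have := hrmin ⟨hmid, h, by linarith [hs.2.2, hr.2.2, ht.2]⟩
    have : r = t := le_antisymm (by linarith [hs.2.2]) hr.2.1
    exact this ▸ hr.1

end Arc

/-! ### The shorter arc as a parametrized circle arc -/

section ShorterArc

variable {E : Type*} [NormedAddCommGroup E] [InnerProductSpace ℝ E]

open InnerProductGeometry

/-- Two non-collinear vectors of the same norm are on a circle in the plane of two orthonormal
vectors. -/
theorem exists_orthonormal_of_norm_eq {x y : E} {R : ℝ} (hR : 0 < R) (hx : ‖x‖ = R) (hy : ‖y‖ = R)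
    (hsin : Real.sin (angle x y) ≠ 0) :
    ∃ e₁ e₂ : E, ‖e₁‖ = 1 ∧ ‖e₂‖ = 1 ∧ inner ℝ e₁ e₂ = 0 ∧ x = R • e₁ ∧
      y = R • (Real.cos (angle x y) • e₁ + Real.sin (angle x y) • e₂) := by
  set θ := angle x y with hθ
  set u := R⁻¹ • x with hu
  set v := R⁻¹ • y with hv
  have hnu : ‖u‖ = 1 := by
    rw [hu, norm_smul, hx, norm_inv, Real.norm_of_nonneg hR.le, inv_mul_cancel₀ hR.ne']
  have hnv : ‖v‖ = 1 := by
    rw [hv, norm_smul, hy, norm_inv, Real.norm_of_nonneg hR.le, inv_mul_cancel₀ hR.ne']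
  have huv : inner ℝ u v = Real.cos θ := by
    rw [inner_eq_cos_angle_of_norm_eq_one hnu hnv, hu, hv,
      angle_smul_left_of_pos _ _ (inv_pos.2 hR), angle_smul_right_of_pos _ _ (inv_pos.2 hR)]
  refine ⟨u, (Real.sin θ)⁻¹ • (v - Real.cos θ • u), hnu, ?_, ?_, ?_, ?_⟩
  · refine (pow_eq_one_iff_of_nonneg (norm_nonneg _) two_ne_zero).1 ?_
    rw [norm_smul, mul_pow, norm_sub_sq_real, inner_smul_right v u, norm_smul (Real.cos θ) u, hnu,
      hnv, real_inner_comm, huv, norm_inv, Real.norm_eq_abs, Real.norm_eq_abs, inv_pow, sq_abs,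
      mul_one, sq_abs]
    rw [inv_mul_eq_one₀ (pow_ne_zero 2 hsin), Real.sin_sq]
    ring
  · rw [inner_smul_right, inner_sub_right, inner_smul_right u u, huv, real_inner_self_eq_norm_sq, hnu]
    ring
  · rw [hu, smul_inv_smul₀ hR.ne']
  · rw [smul_inv_smul₀ hsin, add_sub_cancel, hv, smul_inv_smul₀ hR.ne']

theorem image_circleArc_eq_shorterArc {D : ℕ} {z q₁ q₂ e₁ e₂ : EuclideanSpace ℝ (Fin D)} {R θ : ℝ}
    (hR : 0 < R) (h₁ : ‖e₁‖ = 1) (h₂ : ‖e₂‖ = 1) (h₁₂ : inner ℝ e₁ e₂ = 0)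
    (hθ : 0 < θ) (hθ' : θ < Real.pi) (hq₁ : q₁ - z = R • e₁)
    (hq₂ : q₂ - z = R • (Real.cos θ • e₁ + Real.sin θ • e₂)) :
    circleArc z e₁ e₂ R '' Set.Icc 0 (R * θ) = shorterArc z q₁ q₂ := by
  have hsin : 0 < Real.sin θ := Real.sin_pos_of_pos_of_lt_pi hθ hθ'
  have hn : dist q₁ z = R := by
    rw [dist_eq_norm, hq₁, norm_smul, h₁, Real.norm_of_nonneg hR.le, mul_one]
  ext x
  constructor
  · rintro ⟨t, ⟨ht0, htθ⟩, rfl⟩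
    have hs0 : 0 ≤ t / R := by positivity
    have hsθ : t / R ≤ θ := by rw [div_le_iff₀ hR]; linarith
    -- The sector coefficients solve a linear system in the frame `e₁`, `e₂`, with determinant `sin
    -- θ`.
    refine ⟨by rw [hn, dist_eq_norm, norm_circleArc_sub hR h₁ h₂ h₁₂],
      Real.sin (θ - t / R) / Real.sin θ, Real.sin (t / R) / Real.sin θ,
      div_nonneg (Real.sin_nonneg_of_nonneg_of_le_pi (by linarith) (by linarith)) hsin.le,
      div_nonneg (Real.sin_nonneg_of_nonneg_of_le_pi hs0 (by linarith)) hsin.le, ?_⟩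
    have e1 : Real.sin (θ - t / R) / Real.sin θ + Real.sin (t / R) / Real.sin θ * Real.cos θ =
        Real.cos (t / R) := by
      rw [Real.sin_sub]; field_simp; ring
    have e2 : Real.sin (t / R) / Real.sin θ * Real.sin θ = Real.sin (t / R) := by field_simp
    rw [hq₁, hq₂, circleArc, add_sub_cancel_left, ← e1]
    nth_rw 2 [← e2]
    module
  · rintro ⟨hx, α, β, hα, hβ, hxz⟩
    rw [hn, dist_eq_norm] at hx
    set C := α + β * Real.cos θ with hC
    set S := β * Real.sin θ with hS
    have hxz' : x - z = R • (C • e₁ + S • e₂) := by rw [hxz, hq₁, hq₂, hC, hS]; module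
    have hCS : C ^ 2 + S ^ 2 = 1 := by
      rw [hxz', norm_smul, Real.norm_of_nonneg hR.le] at hx
      have h := mul_left_cancel₀ hR.ne' (hx.trans (mul_one R).symm)
      have h' : ‖C • e₁ + S • e₂‖ ^ 2 = 1 := by rw [h, one_pow]
      rw [norm_add_sq_real, inner_smul_left, inner_smul_right, h₁₂, norm_smul, norm_smul, h₁, h₂,
        mul_one, mul_one, Real.norm_eq_abs, Real.norm_eq_abs, sq_abs, sq_abs] at h'
      simpa using h'
    have hS0 : 0 ≤ S := mul_nonneg hβ hsin.le
    set s := Real.arccos C with hs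
    have hcos : Real.cos s = C := Real.cos_arccos (by nlinarith) (by nlinarith)
    have hsins : Real.sin s = S := by
      rw [hs, Real.sin_arccos, ← hCS, add_sub_cancel_left, Real.sqrt_sq hS0]
    -- Beyond `θ` the coefficient of `q₁ - z` would be negative, since `α * sin θ = sin (θ - s)`.
    have hsθ : s ≤ θ := by
      by_contra! hlt
      have h1 : Real.sin (θ - s) < 0 :=
        Real.sin_neg_of_neg_of_neg_pi_lt (by linarith) (by linarith [Real.arccos_le_pi C])
      have h2 : Real.sin (θ - s) = α * Real.sin θ := by
        rw [Real.sin_sub, hcos, hsins, hC, hS]; ring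
      have := mul_nonneg hα hsin.le
      linarith
    refine ⟨R * s, ⟨mul_nonneg hR.le (Real.arccos_nonneg C), by gcongr⟩, ?_⟩
    rw [circleArc, mul_div_cancel_left₀ _ hR.ne', hcos, hsins, ← hxz', add_sub_cancel]

end ShorterArc

/-! ### Reach as uniqueness of nearest points -/

section Reach

variable {D : ℕ} {M : Set (EuclideanSpace ℝ (Fin D))} {τ : ℝ}

theorem le_infDist_of_mem_medialAxis (hne : M.Nonempty) (hreach : reach M = ENNReal.ofReal τ)
    {x : EuclideanSpace ℝ (Fin D)} (hx : x ∈ medialAxis M) : τ ≤ Metric.infDist x M := by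
  have h : ENNReal.ofReal τ ≤ Metric.infEDist x M := hreach ▸ iInf₂_le x hx
  exact (ENNReal.ofReal_le_iff_le_toReal (Metric.infEDist_ne_top hne)).1 h

theorem nearest_unique_of_infDist_lt_reach (hreach : reach M = ENNReal.ofReal τ)
    (x : EuclideanSpace ℝ (Fin D)) (hx : Metric.infDist x M < τ)
    (p : EuclideanSpace ℝ (Fin D)) (hp : p ∈ M) (q : EuclideanSpace ℝ (Fin D)) (hq : q ∈ M)
    (hxp : dist x p = Metric.infDist x M) (hxq : dist x q = Metric.infDist x M) : q = p := by
  by_contra hne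
  refine hx.not_ge (le_infDist_of_mem_medialAxis ⟨p, hp⟩ hreach ⟨q, hq, p, hp, hne, ?_, ?_⟩)
  · rw [dist_comm, hxq]
  · rw [dist_comm, hxp]

end Reach

/-! ### Paths in `M` and reparametrization by arc length -/

section Paths

variable {D : ℕ} {M : Set (EuclideanSpace ℝ (Fin D))} {p q z : EuclideanSpace ℝ (Fin D)} {a b : ℝ}
  {c : ℝ → EuclideanSpace ℝ (Fin D)}

theorem IsPathIn.lt (h : IsPathIn M p q a b c) (hpq : p ≠ q) : a < b :=
  h.le.lt_of_ne fun hab => hpq (by rw [← h.source, ← h.target, hab])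

theorem IsPathIn.hasDerivWithinAt_sub (h : IsPathIn M p q a b c) (z : EuclideanSpace ℝ (Fin D))
    (t : ℝ) (ht : t ∈ Set.Icc a b) :
    HasDerivWithinAt (fun t => c t - z) (derivWithin c (Set.Icc a b) t) (Set.Icc a b) t :=
  ((h.contDiffOn.differentiableOn one_ne_zero t ht).hasDerivWithinAt).sub_const z

theorem IsPathIn.continuousOn_derivWithin (h : IsPathIn M p q a b c) (hab : a < b) :
    ContinuousOn (derivWithin c (Set.Icc a b)) (Set.Icc a b) :=
  h.contDiffOn.continuousOn_derivWithin (uniqueDiffOn_Icc hab) le_rfl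

theorem isPathIn_circleArc {e₁ e₂ : EuclideanSpace ℝ (Fin D)} {R ℓ : ℝ} (hℓ : 0 ≤ ℓ)
    (hmem : ∀ t ∈ Set.Icc 0 ℓ, circleArc z e₁ e₂ R t ∈ M) (hp : circleArc z e₁ e₂ R 0 = p)
    (hq : circleArc z e₁ e₂ R ℓ = q) : IsPathIn M p q 0 ℓ (circleArc z e₁ e₂ R) :=
  ⟨hℓ, ((contDiff_circleArc z e₁ e₂ R).of_le (by exact_mod_cast le_top)).contDiffOn, hmem, hp, hq⟩

theorem pathLength_of_norm_derivWithin_eq_one (hab : a ≤ b)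
    (h : ∀ t ∈ Set.Icc a b, ‖derivWithin c (Set.Icc a b) t‖ = 1) : pathLength a b c = b - a := by
  rw [pathLength, intervalIntegral.integral_congr (g := fun _ => (1 : ℝ))
    (fun t ht => h t (Set.uIcc_of_le hab ▸ ht))]
  simp

theorem pathLength_circleArc {e₁ e₂ : EuclideanSpace ℝ (Fin D)} {R ℓ : ℝ} (hR : R ≠ 0)
    (h₁ : ‖e₁‖ = 1) (h₂ : ‖e₂‖ = 1) (h₁₂ : inner ℝ e₁ e₂ = 0) (hℓ : 0 < ℓ) :
    pathLength 0 ℓ (circleArc z e₁ e₂ R) = ℓ := by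
  rw [pathLength_of_norm_derivWithin_eq_one hℓ.le, sub_zero]
  intro t ht
  rw [((contDiff_circleArc z e₁ e₂ R).differentiable (by simp) t).derivWithin
    (uniqueDiffOn_Icc hℓ t ht), norm_deriv_circleArc hR h₁ h₂ h₁₂]

/-- A path joining the endpoints of an arc outside the ball the arc bounds, and not longer than the
arc, is the arc, up to its parametrization by arc length. -/
theorem IsPathIn.eqOn_circleArc_of_pathLength_le (h : IsPathIn M p q a b c)
    {e₁ e₂ : EuclideanSpace ℝ (Fin D)} {R θ : ℝ} (hab : a < b)
    (hz : ∀ x ∈ M, R ≤ ‖x - z‖) (hR : 0 < R) (h₁ : ‖e₁‖ = 1) (h₂ : ‖e₂‖ = 1)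
    (h₁₂ : inner ℝ e₁ e₂ = 0) (hθ : InnerProductGeometry.angle (p - z) (q - z) = θ)
    (hsin : Real.sin θ ≠ 0) (hp : p - z = R • e₁)
    (hq : q - z = R • (Real.cos θ • e₁ + Real.sin θ • e₂)) (hlen : pathLength a b c ≤ R * θ) :
    ∀ t ∈ Set.Icc a b,
      c t = circleArc z e₁ e₂ R (∫ s in a..t, ‖derivWithin c (Set.Icc a b) s‖) := by
  intro t ht
  have hx := h.hasDerivWithinAt_sub z
  have hx' := h.continuousOn_derivWithin hab
  have hout : ∀ t ∈ Set.Icc a b, R ≤ ‖c t - z‖ := fun t ht => hz _ (h.mapsTo ht)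
  have hlen' : ∫ t in a..b, ‖derivWithin c (Set.Icc a b) t‖ ≤
      R * InnerProductGeometry.angle (c a - z) (c b - z) := by
    rw [h.source, h.target, hθ]; exact hlen
  have hnorm : ‖c t - z‖ = R := by
    rw [norm_eq_of_integral_norm_deriv_le hab hR hx hx' hout hlen' t ht, h.source, hp, norm_smul,
      h₁, Real.norm_of_nonneg hR.le, mul_one]
  obtain ⟨ha, hb⟩ := angle_eq_of_integral_norm_deriv_le hR hx hx' hout hlen' ht
  simp only [h.source, h.target] at ha hb
  rw [hθ] at hb
  rw [hp, InnerProductGeometry.angle_smul_left_of_pos _ _ hR] at ha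
  rw [hq, InnerProductGeometry.angle_smul_right_of_pos _ _ hR] at hb
  have hiR : 0 < R⁻¹ := inv_pos.2 hR
  rw [← InnerProductGeometry.angle_smul_right_of_pos _ _ hiR] at ha
  rw [← InnerProductGeometry.angle_smul_left_of_pos _ _ hiR] at hb
  have hu : ‖R⁻¹ • (c t - z)‖ = 1 := by
    rw [norm_smul, hnorm, Real.norm_of_nonneg hiR.le, inv_mul_cancel₀ hR.ne']
  have := eq_cos_smul_add_sin_smul hu h₁ h₂ h₁₂ hsin ha hb
  rw [circleArc, ← this, smul_inv_smul₀ hR.ne', add_sub_cancel]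

/-- A continuous function integrates to a primitive that covers every value up to its total. -/
theorem image_primitive_norm {f : ℝ → EuclideanSpace ℝ (Fin D)} (hab : a ≤ b)
    (hf : ContinuousOn f (Set.Icc a b)) :
    (fun t => ∫ s in a..t, ‖f s‖) '' Set.Icc a b = Set.Icc 0 (∫ s in a..b, ‖f s‖) := by
  have hint : IntervalIntegrable (fun t => ‖f t‖) MeasureTheory.volume a b :=
    hf.norm.intervalIntegrable_of_Icc hab
  have hcont : ContinuousOn (fun t => ∫ s in a..t, ‖f s‖) (Set.Icc a b) :=
    (intervalIntegral.continuousOn_primitive_interval' hint Set.left_mem_uIcc).mono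
      Set.Icc_subset_uIcc
  refine Set.Subset.antisymm ?_ ?_
  · rintro _ ⟨t, ht, rfl⟩
    refine ⟨intervalIntegral.integral_nonneg ht.1 fun _ _ => norm_nonneg _, ?_⟩
    exact intervalIntegral.integral_mono_interval le_rfl ht.1 ht.2
      (Filter.Eventually.of_forall fun _ => norm_nonneg _) hint
  · have := intermediate_value_Icc hab hcont
    simpa using this

end Paths

/-! ### Assembly of the arc inclusion and the length comparison -/

theorem mainTheorem2 {D d : ℕ} (M : Set (EuclideanSpace ℝ (Fin D)))
    (hcompact : IsCompact M) (hM : IsSubmanifold 1 d M)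
    (τ : ℝ) (hτ : 0 < τ) (hreach : reach M = ENNReal.ofReal τ)
    (q₁ q₂ z₀ : EuclideanSpace ℝ (Fin D)) (hpair : IsReachAttainingPair M q₁ q₂ z₀)
    (hsize : ‖q₁ - q₂‖ < 2 * τ) :
    (dist q₁ z₀ = τ ∧ dist q₂ z₀ = τ) ∧
    shorterArc z₀ q₁ q₂ ⊆ M ∧
    ∃ (ℓ : ℝ) (γ : ℝ → EuclideanSpace ℝ (Fin D)),
      -- `γ : [0, ℓ] → M` is an arc-length parametrization of the arc, of curvature `1 / τ`
      ℓ = τ * EuclideanGeometry.angle q₁ z₀ q₂ ∧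
      γ '' Set.Icc 0 ℓ = shorterArc z₀ q₁ q₂ ∧
      ContDiff ℝ ∞ γ ∧
      (∀ t ∈ Set.Icc 0 ℓ, ‖deriv γ t‖ = 1) ∧
      (∀ t ∈ Set.Icc 0 ℓ, ‖deriv (deriv γ) t‖ = 1 / τ) ∧
      -- it is a geodesic of `M` from `q₁` to `q₂`
      IsGeodesic M q₁ q₂ 0 ℓ γ ∧
      -- and it is the only one, up to the choice of the parametrization
      (∀ (ℓ' : ℝ) (c : ℝ → EuclideanSpace ℝ (Fin D)), IsGeodesic M q₁ q₂ 0 ℓ' c →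
        (∀ t ∈ Set.Icc 0 ℓ', ‖derivWithin c (Set.Icc 0 ℓ') t‖ = 1) →
          ℓ' = ℓ ∧ Set.EqOn c γ (Set.Icc 0 ℓ)) ∧
      (∀ (a b : ℝ) (c : ℝ → EuclideanSpace ℝ (Fin D)), IsGeodesic M q₁ q₂ a b c →
        c '' Set.Icc a b = shorterArc z₀ q₁ q₂) := by
  have hne : M.Nonempty := ⟨q₁, hpair.left_mem⟩
  have hinf : τ ≤ Metric.infDist z₀ M := le_infDist_of_mem_medialAxis hne hreach hpair.axis_mem
  have hout : ∀ p ∈ M, τ ≤ ‖p - z₀‖ := fun p hp => by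
    rw [← dist_eq_norm, dist_comm]
    exact hinf.trans (Metric.infDist_le_dist_of_mem hp)
  have hle : ∀ q, edist q z₀ ≤ reach M → ‖q - z₀‖ ≤ τ := fun q hq => by
    rw [hreach, edist_dist, ENNReal.ofReal_le_ofReal_iff hτ.le] at hq
    rwa [← dist_eq_norm]
  have hn₁ : ‖q₁ - z₀‖ = τ := le_antisymm (hle _ hpair.left_le) (hout _ hpair.left_mem)
  have hn₂ : ‖q₂ - z₀‖ = τ := le_antisymm (hle _ hpair.right_le) (hout _ hpair.right_mem)
  set θ := InnerProductGeometry.angle (q₁ - z₀) (q₂ - z₀) with hθ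
  have hθ0 : 0 < θ := by
    refine (InnerProductGeometry.angle_nonneg _ _).lt_of_ne fun h => hpair.ne ?_
    have := InnerProductGeometry.norm_sub_eq_abs_sub_norm_of_angle_eq_zero h.symm
    rw [sub_sub_sub_cancel_right, hn₁, hn₂, sub_self, abs_zero, norm_eq_zero, sub_eq_zero] at this
    exact this
  have hθπ : θ < Real.pi := by
    refine (InnerProductGeometry.angle_le_pi _ _).lt_of_ne fun h => ?_
    have := InnerProductGeometry.norm_sub_eq_add_norm_of_angle_eq_pi h
    rw [sub_sub_sub_cancel_right, hn₁, hn₂] at this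
    linarith
  have hsin : Real.sin θ ≠ 0 := (Real.sin_pos_of_pos_of_lt_pi hθ0 hθπ).ne'
  obtain ⟨e₁, e₂, h₁, h₂, h₁₂, hq₁, hq₂⟩ := exists_orthonormal_of_norm_eq hτ hn₁ hn₂ hsin
  rw [← hθ] at hq₂
  have hℓ : 0 < τ * θ := mul_pos hτ hθ0
  have hstart : circleArc z₀ e₁ e₂ τ 0 = q₁ := by simp [circleArc, ← hq₁]
  have hend : circleArc z₀ e₁ e₂ τ (τ * θ) = q₂ := by
    rw [circleArc, mul_div_cancel_left₀ _ hτ.ne', ← hq₂, add_sub_cancel]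
  have himage := image_circleArc_eq_shorterArc hτ h₁ h₂ h₁₂ hθ0 hθπ hq₁ hq₂
  have hmem := circleArc_mem (ℓ := τ * θ) hcompact (nearest_unique_of_infDist_lt_reach hreach) hout
    hτ h₁ h₂ h₁₂ (by gcongr) (hstart ▸ hpair.left_mem) (hend ▸ hpair.right_mem)
  have hpath := isPathIn_circleArc hℓ.le hmem hstart hend
  have hlength := pathLength_circleArc (z := z₀) hτ.ne' h₁ h₂ h₁₂ hℓ
  have hmin : ∀ (a b : ℝ) (c : ℝ → EuclideanSpace ℝ (Fin D)), IsPathIn M q₁ q₂ a b c →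
      τ * θ ≤ pathLength a b c := fun a b c hc => by
    have := mul_angle_le_integral_norm_deriv hc.le hτ (hc.hasDerivWithinAt_sub z₀)
      (hc.continuousOn_derivWithin (hc.lt hpair.ne)) (fun t ht => hout _ (hc.mapsTo ht))
    rwa [hc.source, hc.target] at this
  have hgeod : ∀ (a b : ℝ) (c : ℝ → EuclideanSpace ℝ (Fin D)), IsGeodesic M q₁ q₂ a b c →
      pathLength a b c = τ * θ ∧ ∀ t ∈ Set.Icc a b,
        c t = circleArc z₀ e₁ e₂ τ (∫ s in a..t, ‖derivWithin c (Set.Icc a b) s‖) := by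
    intro a b c hc
    have hlen : pathLength a b c ≤ τ * θ := hlength ▸ hc.2 _ _ _ hpath
    exact ⟨le_antisymm hlen (hmin _ _ _ hc.1), hc.1.eqOn_circleArc_of_pathLength_le
      (hc.1.lt hpair.ne) hout hτ h₁ h₂ h₁₂ hθ.symm hsin hq₁ hq₂ hlen⟩
  refine ⟨⟨by rw [dist_eq_norm, hn₁], by rw [dist_eq_norm, hn₂]⟩, ?_, τ * θ,
    circleArc z₀ e₁ e₂ τ, rfl, himage, contDiff_circleArc _ _ _ _,
    fun t _ => norm_deriv_circleArc hτ.ne' h₁ h₂ h₁₂ t,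
    fun t _ => norm_deriv_deriv_circleArc hτ h₁ h₂ h₁₂ t,
    ⟨hpath, fun a b c hc => hlength.le.trans (hmin a b c hc)⟩, ?_, ?_⟩
  · rw [← himage]
    rintro _ ⟨t, ht, rfl⟩
    exact hmem t ht
  · intro ℓ' c hc hunit
    obtain ⟨hlen, heq⟩ := hgeod 0 ℓ' c hc
    have hℓ' : ℓ' = τ * θ := by
      rw [← hlen, pathLength_of_norm_derivWithin_eq_one hc.1.le hunit, sub_zero]
    refine ⟨hℓ', fun t ht => ?_⟩
    rw [← hℓ'] at ht
    -- At unit speed the arc length from `0` to `t` is `t`, so the reparametrization is trivial.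
    rw [heq t ht, intervalIntegral.integral_congr (g := fun _ => (1 : ℝ)) fun s hs => ?_]
    · simp
    · rw [Set.uIcc_of_le ht.1] at hs
      exact hunit s ⟨hs.1, hs.2.trans ht.2⟩
  · intro a b c hc
    obtain ⟨hlen, heq⟩ := hgeod a b c hc
    have hprim := image_primitive_norm hc.1.le (hc.1.continuousOn_derivWithin (hc.1.lt hpair.ne))
    -- The arc length function maps `[a, b]` onto `[0, τ * θ]`, so the path covers the whole arc
    -- even if its speed vanishes somewhere.
    rw [← himage, ← hlen, pathLength, ← hprim, Set.image_image]
    exact Set.image_congr heq
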